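/- Let $d\ge 1$, let $N\ge 1$ be an integer and let $\ell=(\ell_1,\dots,\ell_{d+1})$ be positive integers with $\ell_i\le N$ for all $i$ and $\ell_i+\ell_j\ge N$ for all $i\ne j$. Write $|y|$ for the sum of the entries of $y$ and $(a)_k=a(a+1)\cdots(a+k-1)$, and let $$V^d_{\ell,N}=\{x\in\mathbb N_0^d:\ x_i\le \ell_i\ (1\le i\le d),\ N-\ell_{d+1}\le |x|\le N\}.$$ For $\nu\in\mathbb N_0^d$ and $1\le j\le d$ put $$\mathfrak a_j=\sum_{i=j+1}^{d+1}\ell_i-2\sum_{i=j+1}^{d}\nu_i,\qquad N_j=N-\sum_{i<j}x_i-\sum_{i=j+1}^{d}\nu_i,$$ and define the Hahn polynomials with negative integer parameters by $$\mathsf Q_\nu(x;\ell,N)=\prod_{j=1}^d(-N_j)_{\nu_j}\sum_{k=0}^{\nu_j}\frac{(-\nu_j)_k\,(\nu_j-\ell_j-\mathfrak a_j-1)_k\,(-x_j)_k}{(-\ell_j)_k\,(-N_j)_k\,k!}.$$ Let $$\mathcal H^d_{\ell,N}=\{\nu\in\mathbb N_0^d:\ \nu_i\le \ell_i\ (1\le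 i\le d),\ |\nu|\le N\},$$ $$H^d_{\ell,N}=\{\nu\in\mathbb N_0^d:\ |\nu|\le N,\ |\nu|\le|\ell|-N,\ \nu_j\le\ell_j,\ \nu_j\le\mathfrak a_j\ (1\le j\le d)\}.$$ (i) For every $\nu\in\mathcal H^d_{\ell,N}$, $\mathsf Q_\nu(\cdot;\ell,N)$ is a well defined polynomial, and so is well defined on $V^d_{\ell,N}$: no denominator of the formula vanishes identically in $x\in\mathbb R^d$, and there is exactly one polynomial in $x_1,\dots,x_d$ with real coefficients that agrees with the formula at every $x\in\mathbb R^d$ at which none of its denominators vanishes; at all other points $\mathsf Q_\nu$ is given by this polynomial. (ii) If $\nu\in\mathcal H^d_{\ell,N}\setminus H^d_{\ell,N}$, then $\mathsf Q_\nu(x;\ell,N)=0$ for every $x\in V^d_{\ell,N}$. -/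

import Mathlib

open Finset

noncomputable section

/-- The Pochhammer symbol `(a)_k = a (a + 1) ⋯ (a + k - 1)`. -/
def poch (a : ℝ) (k : ℕ) : ℝ := (ascPochhammer ℝ k).eval a

/-- The classical Hahn polynomial `Q_n(x; a, b, M)`, i.e. the terminating series
`₃F₂(-n, n + a + b + 1, -x; a + 1, -M; 1)`. The value is meaningful only when none of the
denominators vanishes, see `HahnDefined`. -/
def classicalHahn (n : ℕ) (x a b M : ℝ) : ℝ :=
  ∑ k ∈ range (n + 1),
    (poch (-n) k * poch (n + a + b + 1) k * poch (-x) k) /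
      (poch (a + 1) k * poch (-M) k * k.factorial)

/-- No denominator in the series for `Q_n(x; a, b, M)` vanishes. -/
def HahnDefined (n : ℕ) (a M : ℝ) : Prop :=
  ∀ k ≤ n, poch (a + 1) k ≠ 0 ∧ poch (-M) k ≠ 0

/-- Sum of the entries of `y` strictly before position `j`. -/
def sumBefore {d : ℕ} (y : Fin d → ℝ) (j : Fin d) : ℝ := ∑ i ∈ univ.filter (· < j), y i

/-- Sum of the entries of `ν` strictly after position `j`. -/
def sumAfter {d : ℕ} (ν : Fin d → ℕ) (j : Fin d) : ℕ := ∑ i ∈ univ.filter (j < ·), ν i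

/-- `𝔞_j = (sum of ℓ_i over i > j, including the last entry) - 2 (sum of ν_i over i > j)`. -/
def zaParam {d : ℕ} (ℓ : Fin (d + 1) → ℕ) (ν : Fin d → ℕ) (j : Fin d) : ℤ :=
  ((∑ i ∈ univ.filter (j.castSucc < ·), ℓ i : ℕ) : ℤ) - 2 * (sumAfter ν j : ℤ)

/-- `N_j = N - (x_1 + ⋯ + x_{j-1}) - (ν_{j+1} + ⋯ + ν_d)`. -/
def levelN {d : ℕ} (N : ℕ) (ν : Fin d → ℕ) (x : Fin d → ℝ) (j : Fin d) : ℝ :=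
  N - sumBefore x j - sumAfter ν j

/-- The product formula for the Hahn polynomial `𝖰_ν(x; ℓ, N)` with negative integer parameters,
`∏_j (-N_j)_{ν_j} Q_{ν_j}(x_j; -ℓ_j - 1, -𝔞_j - 1, N_j)`, as an expression at the point `x`. -/
def hahnFormula {d : ℕ} (ℓ : Fin (d + 1) → ℕ) (N : ℕ) (ν : Fin d → ℕ) (x : Fin d → ℝ) : ℝ :=
  ∏ j, poch (-levelN N ν x j) (ν j) *
    classicalHahn (ν j) (x j) (-(ℓ j.castSucc : ℝ) - 1) (-(zaParam ℓ ν j : ℝ) - 1) (levelN N ν x j)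

/-- No denominator of `hahnFormula ℓ N ν` vanishes at the point `x`. -/
def HahnFormulaDefined {d : ℕ} (ℓ : Fin (d + 1) → ℕ) (N : ℕ) (ν : Fin d → ℕ) (x : Fin d → ℝ) :
    Prop :=
  ∀ j, HahnDefined (ν j) (-(ℓ j.castSucc : ℝ) - 1) (levelN N ν x j)

/-- `P` is the polynomial given by the product formula for `𝖰_ν(·; ℓ, N)`: the formula makes sense
somewhere (hence, its denominators being polynomials in `x`, on a nonempty Zariski-open set), and
`P` takes the value of the formula wherever the formula makes sense. At the remaining points the
value is that of `P`, i.e. the one obtained after cancelling the denominators. -/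
def IsHahnPolynomial {d : ℕ} (ℓ : Fin (d + 1) → ℕ) (N : ℕ) (ν : Fin d → ℕ)
    (P : MvPolynomial (Fin d) ℝ) : Prop :=
  (∃ x, HahnFormulaDefined ℓ N ν x) ∧
    ∀ x, HahnFormulaDefined ℓ N ν x → MvPolynomial.eval x P = hahnFormula ℓ N ν x

/-- The lattice points `V^d_{ℓ,N}` of the polyhedron. -/
def hahnV {d : ℕ} (ℓ : Fin (d + 1) → ℕ) (N : ℕ) : Set (Fin d → ℕ) :=
  {x | (∀ i, x i ≤ ℓ i.castSucc) ∧ (N : ℤ) - ℓ (Fin.last d) ≤ ((∑ i, x i : ℕ) : ℤ) ∧ ∑ i, x i ≤ N}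

/-- The index set `H^d_{ℓ,N}`. -/
def hahnH {d : ℕ} (ℓ : Fin (d + 1) → ℕ) (N : ℕ) : Set (Fin d → ℕ) :=
  {ν | ∑ i, ν i ≤ N ∧ ((∑ i, ν i : ℕ) : ℤ) ≤ ((∑ i, ℓ i : ℕ) : ℤ) - N ∧
    ∀ j, ν j ≤ ℓ j.castSucc ∧ (ν j : ℤ) ≤ zaParam ℓ ν j}

/-- The larger index set `𝓗^d_{ℓ,N}`. -/
def hahnCalH {d : ℕ} (ℓ : Fin (d + 1) → ℕ) (N : ℕ) : Set (Fin d → ℕ) :=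
  {ν | (∀ i, ν i ≤ ℓ i.castSucc) ∧ ∑ i, ν i ≤ N}

end

/-!
Write `x↓k` for the falling factorial, and clear the denominators of one factor: up to the constant
`ℓ↓n`, the factor `(-M)_n Q_n(x; -ℓ - 1, -a - 1, M)` becomes a polynomial in all its parameters
(`clearedHahn`), which gives (i). Applying Chu–Vandermonde twice, at `M = x + y` it equals
`∑_{m + j = n} (-1)^j C(n, m) (a - j)↓m (ℓ - m)↓j x↓m y↓j`.
For integers `0 ≤ x ≤ ℓ` and `0 ≤ y ≤ a` this vanishes unless `n ≤ a`, `n ≤ x + y` and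
`n ≤ (ℓ - x) + (a - y)`: in the first two cases every term is zero, and in the last one the sum is
proportional to `∑ (-1)^j C(n, m) (ℓ - m)↓(ℓ - x) (a - j)↓(a - y)`, the `n`-th difference of a
polynomial of degree `(ℓ - x) + (a - y)`.

For (ii), complete `x` by `x_{d+1} = N - |x|`, so that `0 ≤ x ≤ ℓ` entrywise. Going from `j = d`
down to `j = 1`, nonvanishing of the factors propagates the inequalities
`∑_{i ≥ j} ν_i ≤ ∑_{i ≥ j} x_i` and `∑_{i ≥ j} ν_i ≤ ∑_{i ≥ j} (ℓ_i - x_i)` and yields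
`ν_j ≤ 𝔞_j`; the last step gives `|ν| ≤ |ℓ| - N`.
-/

local notation:80 x:80 "↓" k:81 => Polynomial.eval x (descPochhammer _ k)

theorem sum_antidiagonal_antidiagonal_assoc {A M : Type*} [AddCommMonoid A] [HasAntidiagonal A]
    [AddCommMonoid M] (f : A → A → A → M) (n : A) :
    ∑ p ∈ antidiagonal n, ∑ q ∈ antidiagonal p.2, f p.1 q.1 q.2 =
      ∑ p ∈ antidiagonal n, ∑ q ∈ antidiagonal p.1, f q.1 q.2 p.2 := by
  rw [sum_sigma', sum_sigma']
  refine sum_nbij' (fun ⟨⟨i, _⟩, ⟨j, k⟩⟩ => ⟨(i + j, k), (i, j)⟩)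
    (fun ⟨⟨_, k⟩, ⟨i, j⟩⟩ => ⟨(i, j + k), (j, k)⟩) ?_ ?_ ?_ ?_ ?_ <;>
  grind [HasAntidiagonal.mem_antidiagonal]

section FallingFactorial

variable {R : Type*} [CommRing R]

theorem map_descPochhammer_eval {S : Type*} [CommRing S] (f : R →+* S) (x : R) (k : ℕ) :
    f (x↓k) = (f x)↓k := by
  rw [← descPochhammer_map f, Polynomial.eval_map_apply]

theorem descPochhammer_eval_add_index (x : R) (m k : ℕ) : x↓(m + k) = x↓m * (x - m)↓k := by
  simp [← descPochhammer_mul]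

theorem neg_one_pow_mul_descPochhammer_eval (x : R) (k : ℕ) :
    (-1) ^ k * x↓k = (k - 1 - x)↓k := by
  rw [← ascPochhammer_eval_neg_eq_descPochhammer, descPochhammer_eval_eq_ascPochhammer]
  congr 1
  ring

theorem descPochhammer_eval_add (x y : R) (n : ℕ) :
    (x + y)↓n = ∑ p ∈ antidiagonal n, n.choose p.1 * (x↓p.1 * y↓p.2) := by
  have smeval_eq_eval (r : R) (k : ℕ) : (descPochhammer ℤ k).smeval r = r↓k := by
    rw [← Polynomial.aeval_eq_smeval, ← descPochhammer_map (algebraMap ℤ R),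
      Polynomial.eval_map_algebraMap]
  simpa only [smeval_eq_eval] using Ring.descPochhammer_smeval_add n (Commute.all x y)

theorem descPochhammer_eval_mul_eval_add_sub (x y : R) (k n : ℕ) :
    x↓k * (x + y - k)↓n =
      ∑ p ∈ antidiagonal n, n.choose p.1 * (x↓(k + p.1) * y↓p.2) := by
  rw [add_sub_right_comm, descPochhammer_eval_add, mul_sum]
  refine sum_congr rfl fun p _ => ?_
  rw [descPochhammer_eval_add_index]
  ring

theorem sum_neg_one_pow_mul_choose_mul_descPochhammer_eval (b c : R) (m : ℕ) :
    ∑ p ∈ antidiagonal m, (-1) ^ p.2 * m.choose p.1 * b↓p.1 * (c - p.1)↓p.2 =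
      (b + (m - 1 - c))↓m := by
  rw [descPochhammer_eval_add]
  refine sum_congr rfl fun ⟨k, i⟩ hp => ?_
  obtain rfl : k + i = m := mem_antidiagonal.1 hp
  have reflect : (-1) ^ i * (c - k)↓i = ((k + i : ℕ) - 1 - c)↓i := by
    rw [neg_one_pow_mul_descPochhammer_eval]
    push_cast
    congr 1
    ring
  rw [← reflect]
  ring

theorem descPochhammer_eval_mul_eval_sub_mul_eval_sub (r : R) (s m j : ℕ) :
    r↓s * (r - s)↓m * (r - m)↓j = r↓(m + j) * (r - m)↓s := by
  rw [← descPochhammer_eval_add_index, add_comm s, descPochhammer_eval_add_index,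
    descPochhammer_eval_add_index]
  ring

theorem descPochhammer_eval_natCast_ne_zero [CharZero R] {m k : ℕ} (h : k ≤ m) :
    (m : R)↓k ≠ 0 := by
  rw [descPochhammer_eval_eq_descFactorial]
  exact_mod_cast (Nat.descFactorial_pos.2 h).ne'

theorem sum_neg_one_pow_mul_choose_mul_eval_eq_zero {n : ℕ} {P : Polynomial R}
    (hP : P.natDegree < n) :
    ∑ p ∈ antidiagonal n, (-1) ^ p.2 * n.choose p.1 * P.eval (p.1 : R) = 0 := by
  have h := congrFun (Polynomial.fwdDiff_iter_eq_zero_of_degree_lt hP) 0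
  rw [fwdDiff_iter_eq_sum_shift] at h
  rw [Nat.sum_antidiagonal_eq_sum_range_succ_mk]
  simpa using h

end FallingFactorial

section ClearedHahn

/-- The Hahn polynomial `(-M)_n Q_n(x; -ℓ - 1, -a - 1, M)` multiplied by `ℓ↓n`. All denominators
being cancelled, it makes sense over any commutative ring, in particular over a polynomial ring. -/
noncomputable def clearedHahn {R : Type*} [CommRing R] (n : ℕ) (x ℓ a M : R) : R :=
  ∑ p ∈ antidiagonal n, (-1) ^ p.2 * n.choose p.1 * (ℓ + a + 1 - n)↓p.1 * (ℓ - p.1)↓p.2 *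
    (x↓p.1 * (M - p.1)↓p.2)

variable {R : Type*} [CommRing R]

theorem map_clearedHahn {S : Type*} [CommRing S] (f : R →+* S) (n : ℕ) (x ℓ a M : R) :
    f (clearedHahn n x ℓ a M) = clearedHahn n (f x) (f ℓ) (f a) (f M) := by
  simp only [clearedHahn, map_sum, map_mul, map_pow, map_neg, map_one, map_natCast, map_sub,
    map_add, map_descPochhammer_eval]

theorem clearedHahn_add (n : ℕ) (x y ℓ a : R) :
    clearedHahn n x ℓ a (x + y) =
      ∑ p ∈ antidiagonal n, (-1) ^ p.2 * n.choose p.1 *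
        ((ℓ - p.1)↓p.2 * x↓p.1) * ((a - p.2)↓p.1 * y↓p.2) := by
  let t (k i j : ℕ) : R := (-1) ^ (i + j) * n.choose k * (ℓ + a + 1 - n)↓k * (ℓ - k)↓(i + j) *
    ((i + j).choose i * (x↓(k + i) * y↓j))
  calc clearedHahn n x ℓ a (x + y)
      = ∑ p ∈ antidiagonal n, ∑ q ∈ antidiagonal p.2, t p.1 q.1 q.2 := by
        refine sum_congr rfl fun p _ => ?_
        rw [descPochhammer_eval_mul_eval_add_sub, mul_sum]
        refine sum_congr rfl fun q hq => ?_
        rw [← mem_antidiagonal.1 hq]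
    _ = ∑ p ∈ antidiagonal n, ∑ q ∈ antidiagonal p.1, t q.1 q.2 p.2 :=
        sum_antidiagonal_antidiagonal_assoc t n
    _ = _ := by
        refine sum_congr rfl fun ⟨m, j⟩ hp => ?_
        obtain rfl : m + j = n := mem_antidiagonal.1 hp
        have chu_vandermonde := sum_neg_one_pow_mul_choose_mul_descPochhammer_eval
          (ℓ + a + 1 - (m + j : ℕ)) ℓ m
        have top_eq : ℓ + a + 1 - (m + j : ℕ) + (m - 1 - ℓ) = a - j := by push_cast; ring
        rw [top_eq] at chu_vandermonde
        rw [← chu_vandermonde, sum_mul, mul_sum]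
        refine sum_congr rfl fun ⟨k, i⟩ hq => ?_
        obtain rfl : k + i = m := mem_antidiagonal.1 hq
        have choose_mul : ((k + i + j).choose k * (i + j).choose i : R) =
            (k + i + j).choose (k + i) * (k + i).choose k := by
          have h := Nat.choose_mul (n := k + i + j) (Nat.le_add_right k i)
          rw [Nat.add_sub_cancel_left, show k + i + j - k = i + j by lia] at h
          simpa only [Nat.cast_mul] using congrArg (Nat.cast : ℕ → R) h.symm
        have split : (ℓ - k)↓(i + j) = (ℓ - k)↓i * (ℓ - (k + i : ℕ))↓j := by
          rw [descPochhammer_eval_add_index, Nat.cast_add, sub_add_eq_sub_sub]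
        simp only [t, split]
        linear_combination (-1) ^ (i + j) * (ℓ + a + 1 - (k + i + j : ℕ))↓k * (ℓ - k)↓i *
          (ℓ - (k + i : ℕ))↓j * x↓(k + i) * y↓j * choose_mul

theorem clearedHahn_eq_zero_of_add_lt {n x y : ℕ} (ℓ a : R) (h : x + y < n) :
    clearedHahn n (x : R) ℓ a (x + y) = 0 := by
  rw [clearedHahn_add]
  refine sum_eq_zero fun ⟨m, j⟩ hp => ?_
  have hmj : m + j = n := mem_antidiagonal.1 hp
  rcases lt_or_ge x m with hxm | hmx
  · rw [descPochhammer_eval_coe_nat_of_lt hxm]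
    ring
  · rw [descPochhammer_eval_coe_nat_of_lt (show y < j by lia)]
    ring

theorem clearedHahn_eq_zero_of_lt {n a y : ℕ} (x ℓ : R) (hy : y ≤ a) (h : a < n) :
    clearedHahn n x ℓ a (x + y) = 0 := by
  rw [clearedHahn_add]
  refine sum_eq_zero fun ⟨m, j⟩ hp => ?_
  have hmj : m + j = n := mem_antidiagonal.1 hp
  rcases lt_or_ge y j with hyj | hjy
  · rw [descPochhammer_eval_coe_nat_of_lt hyj]
    ring
  · have hja : j ≤ a := hjy.trans hy
    rw [← Nat.cast_sub hja, descPochhammer_eval_coe_nat_of_lt (show a - j < m by lia)]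
    ring

theorem clearedHahn_sub_eq_zero [IsDomain R] {n s t : ℕ} {ℓ a : R} (hℓ : ℓ↓s ≠ 0)
    (ha : a↓t ≠ 0) (h : s + t < n) : clearedHahn n (ℓ - s) ℓ a (ℓ - s + (a - t)) = 0 := by
  let P : Polynomial R := (descPochhammer R s).comp (Polynomial.C ℓ - Polynomial.X) *
    (descPochhammer R t).comp (Polynomial.X + Polynomial.C (a - n))
  have hP : P.natDegree < n := by
    refine lt_of_le_of_lt ?_ h
    refine Polynomial.natDegree_mul_le_of_le ?_ ?_ <;>
    refine Polynomial.natDegree_comp_le.trans ?_ <;>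
    rw [descPochhammer_natDegree] <;>
    refine mul_le_of_le_one_right (Nat.zero_le _) (by compute_degree)
  have eval_P {m j : ℕ} (hmj : m + j = n) : P.eval (m : R) = (ℓ - m)↓s * (a - j)↓t := by
    have : (m : R) + (a - n) = a - j := by rw [← hmj]; push_cast; ring
    simp [P, this]
  have key : ℓ↓s * a↓t * clearedHahn n (ℓ - s) ℓ a (ℓ - s + (a - t)) =
      ℓ↓n * a↓n * ∑ p ∈ antidiagonal n, (-1) ^ p.2 * n.choose p.1 * P.eval (p.1 : R) := by
    rw [clearedHahn_add, mul_sum, mul_sum]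
    refine sum_congr rfl fun ⟨m, j⟩ hp => ?_
    have hmj : m + j = n := mem_antidiagonal.1 hp
    have hℓn := descPochhammer_eval_mul_eval_sub_mul_eval_sub ℓ s m j
    have han := descPochhammer_eval_mul_eval_sub_mul_eval_sub a t j m
    rw [hmj] at hℓn
    rw [add_comm, hmj] at han
    rw [eval_P hmj]
    calc _ = (-1) ^ j * n.choose m * (ℓ↓s * (ℓ - s)↓m * (ℓ - m)↓j) *
          (a↓t * (a - t)↓j * (a - j)↓m) := by ring
      _ = _ := by rw [hℓn, han]; ring
  rw [sum_neg_one_pow_mul_choose_mul_eval_eq_zero hP, mul_zero] at key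
  exact (mul_eq_zero.1 key).resolve_left (mul_ne_zero hℓ ha)

theorem clearedHahn_eq_zero_of_sub_add_sub_lt [IsDomain R] [CharZero R] {n x y ℓ a : ℕ}
    (hx : x ≤ ℓ) (hy : y ≤ a) (h : (ℓ - x) + (a - y) < n) :
    clearedHahn n (x : R) ℓ a (x + y) = 0 := by
  have key := clearedHahn_sub_eq_zero (R := R)
    (descPochhammer_eval_natCast_ne_zero (Nat.sub_le ℓ x))
    (descPochhammer_eval_natCast_ne_zero (Nat.sub_le a y)) h
  simpa only [Nat.cast_sub, hx, hy, sub_sub_cancel] using key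

theorem le_of_clearedHahn_ne_zero [IsDomain R] [CharZero R] {n x y ℓ a : ℕ} (hx : x ≤ ℓ)
    (hy : y ≤ a) (h : clearedHahn n (x : R) ℓ a (x + y) ≠ 0) :
    n ≤ a ∧ n ≤ x + y ∧ n ≤ (ℓ - x) + (a - y) :=
  ⟨not_lt.1 fun hn => h (clearedHahn_eq_zero_of_lt _ _ hy hn),
    not_lt.1 fun hn => h (clearedHahn_eq_zero_of_add_lt _ _ hn),
    not_lt.1 fun hn => h (clearedHahn_eq_zero_of_sub_add_sub_lt hx hy hn)⟩

end ClearedHahn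

section ClassicalHahn

theorem poch_neg (x : ℝ) (k : ℕ) : poch (-x) k = (-1) ^ k * x↓k :=
  ascPochhammer_eval_neg_eq_descPochhammer ℝ x k

theorem poch_neg_ne_zero_iff {x : ℝ} {k : ℕ} : poch (-x) k ≠ 0 ↔ x↓k ≠ 0 := by
  simp [poch_neg]

theorem hahnDefined_iff {n : ℕ} {ℓ M : ℝ} :
    HahnDefined n (-ℓ - 1) M ↔ ℓ↓n ≠ 0 ∧ M↓n ≠ 0 := by
  have ne_zero_of_le {x : ℝ} (hx : x↓n ≠ 0) {k : ℕ} (hk : k ≤ n) : x↓k ≠ 0 := by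
    rw [← Nat.add_sub_of_le hk, descPochhammer_eval_add_index] at hx
    exact left_ne_zero_of_mul hx
  simp only [HahnDefined, sub_add_cancel, poch_neg_ne_zero_iff]
  exact ⟨fun h => h n le_rfl, fun h k hk => ⟨ne_zero_of_le h.1 hk, ne_zero_of_le h.2 hk⟩⟩

theorem poch_mul_classicalHahn {n : ℕ} {ℓ M : ℝ} (h : HahnDefined n (-ℓ - 1) M) (x a : ℝ) :
    poch (-M) n * classicalHahn n x (-ℓ - 1) (-a - 1) M = (ℓ↓n)⁻¹ * clearedHahn n x ℓ a M := by
  have hn := hahnDefined_iff.1 h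
  rw [classicalHahn, clearedHahn, Nat.sum_antidiagonal_eq_sum_range_succ_mk, mul_sum, mul_sum]
  refine sum_congr rfl fun k hk => ?_
  obtain ⟨l, rfl⟩ := Nat.exists_eq_add_of_le (Nat.lt_succ_iff.1 (mem_range.1 hk))
  have hfac : poch (-(k + l : ℕ)) k / k.factorial = (-1) ^ k * ((k + l).choose k : ℝ) := by
    rw [poch_neg, mul_div_assoc, Nat.cast_choose_eq_descPochhammer_div]
  have hℓ := hn.1
  have hM := hn.2
  rw [descPochhammer_eval_add_index] at hℓ hM
  calc _ = poch (-(k + l : ℕ)) k / k.factorial *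
        (poch (-M) (k + l) * poch (-(ℓ + a + 1 - (k + l : ℕ))) k * poch (-x) k /
          (poch (-ℓ) k * poch (-M) k)) := by ring_nf
    _ = _ := by
      rw [hfac, Nat.add_sub_cancel_left]
      simp only [poch_neg, descPochhammer_eval_add_index]
      have hℓk := left_ne_zero_of_mul hℓ
      have hℓl := right_ne_zero_of_mul hℓ
      have hMk := left_ne_zero_of_mul hM
      have sign : (-1 : ℝ) ^ (k + l) * (-1) ^ k = (-1) ^ l := by
        rw [pow_add, mul_right_comm, ← mul_pow, neg_one_mul, neg_neg, one_pow, one_mul]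
      field_simp
      rw [← sign]
      ring

end ClassicalHahn

theorem mvPolynomial_eq_of_eval_eq {σ R : Type*} [CommRing R] [IsDomain R] [Infinite R]
    {p q D : MvPolynomial σ R} (hD : D ≠ 0)
    (h : ∀ x, MvPolynomial.eval x D ≠ 0 → MvPolynomial.eval x p = MvPolynomial.eval x q) :
    p = q := by
  have hmul : D * (p - q) = 0 := by
    refine MvPolynomial.funext fun x => ?_
    rw [map_mul, map_sub, map_zero, mul_eq_zero, sub_eq_zero]
    exact or_iff_not_imp_left.2 (h x)
  exact sub_eq_zero.1 ((mul_eq_zero.1 hmul).resolve_left hD)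

section HahnPolynomial

variable {d : ℕ} {ℓ : Fin (d + 1) → ℕ} {N : ℕ} {ν : Fin d → ℕ}

/-- The number `N_j` as a polynomial in `x`. -/
noncomputable def levelPoly (N : ℕ) (ν : Fin d → ℕ) (j : Fin d) : MvPolynomial (Fin d) ℝ :=
  N - ∑ i ∈ univ.filter (· < j), MvPolynomial.X (R := ℝ) i - sumAfter ν j

theorem eval_levelPoly (x : Fin d → ℝ) (j : Fin d) :
    MvPolynomial.eval x (levelPoly N ν j) = levelN N ν x j := by
  simp [levelPoly, levelN, sumBefore]

/-- The Hahn polynomial `𝖰_ν(·; ℓ, N)` for `ν ∈ 𝓗^d_{ℓ,N}`, written without denominators in `x`. -/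
noncomputable def hahnPoly (ℓ : Fin (d + 1) → ℕ) (N : ℕ) (ν : Fin d → ℕ) :
    MvPolynomial (Fin d) ℝ :=
  ∏ j, MvPolynomial.C ((ℓ j.castSucc : ℝ)↓(ν j))⁻¹ *
    clearedHahn (ν j) (MvPolynomial.X j) (ℓ j.castSucc) (zaParam ℓ ν j) (levelPoly N ν j)

theorem eval_hahnPoly (x : Fin d → ℝ) :
    MvPolynomial.eval x (hahnPoly ℓ N ν) =
      ∏ j, ((ℓ j.castSucc : ℝ)↓(ν j))⁻¹ *
        clearedHahn (ν j) (x j) (ℓ j.castSucc) (zaParam ℓ ν j) (levelN N ν x j) := by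
  simp only [hahnPoly, map_prod, map_mul, map_clearedHahn, MvPolynomial.eval_C,
    MvPolynomial.eval_X, map_natCast, map_intCast, eval_levelPoly]

theorem eval_hahnPoly_of_hahnFormulaDefined {x : Fin d → ℝ} (hx : HahnFormulaDefined ℓ N ν x) :
    MvPolynomial.eval x (hahnPoly ℓ N ν) = hahnFormula ℓ N ν x := by
  rw [eval_hahnPoly, hahnFormula]
  exact prod_congr rfl fun j _ => (poch_mul_classicalHahn (hx j) _ _).symm

/-- For `ν ∈ 𝓗^d_{ℓ,N}`, the locus where a denominator of the product formula vanishes is the zero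
set of this polynomial. -/
noncomputable def denomPoly (N : ℕ) (ν : Fin d → ℕ) : MvPolynomial (Fin d) ℝ :=
  ∏ j, (levelPoly N ν j)↓(ν j)

theorem eval_denomPoly_ne_zero_iff (hν : ∀ j, ν j ≤ ℓ j.castSucc) {x : Fin d → ℝ} :
    MvPolynomial.eval x (denomPoly N ν) ≠ 0 ↔ HahnFormulaDefined ℓ N ν x := by
  simp only [denomPoly, map_prod, map_descPochhammer_eval, eval_levelPoly, prod_ne_zero_iff,
    mem_univ, true_imp_iff, HahnFormulaDefined, hahnDefined_iff,
    descPochhammer_eval_natCast_ne_zero (hν _), ne_eq, not_false_eq_true, true_and]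

theorem add_sumAfter_le_sum (j : Fin d) : ν j + sumAfter ν j ≤ ∑ i, ν i := by
  rw [sumAfter, ← sum_insert (by simp)]
  exact sum_le_sum_of_subset (subset_univ _)

theorem hahnFormulaDefined_zero (hν : ν ∈ hahnCalH ℓ N) : HahnFormulaDefined ℓ N ν 0 := by
  intro j
  have hj : ν j + sumAfter ν j ≤ N := (add_sumAfter_le_sum j).trans hν.2
  have level : levelN N ν 0 j = ((N - sumAfter ν j : ℕ) : ℝ) := by
    rw [Nat.cast_sub (by lia)]
    simp [levelN, sumBefore]
  rw [hahnDefined_iff, level]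
  exact ⟨descPochhammer_eval_natCast_ne_zero (hν.1 j),
    descPochhammer_eval_natCast_ne_zero (by lia)⟩

theorem isHahnPolynomial_hahnPoly (hν : ν ∈ hahnCalH ℓ N) :
    IsHahnPolynomial ℓ N ν (hahnPoly ℓ N ν) :=
  ⟨⟨0, hahnFormulaDefined_zero hν⟩, fun _ => eval_hahnPoly_of_hahnFormulaDefined⟩

theorem IsHahnPolynomial.eq_hahnPoly (hν : ν ∈ hahnCalH ℓ N) {P : MvPolynomial (Fin d) ℝ}
    (hP : IsHahnPolynomial ℓ N ν P) : P = hahnPoly ℓ N ν := by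
  have eval_denomPoly {x : Fin d → ℝ} := eval_denomPoly_ne_zero_iff (N := N) (x := x) hν.1
  have denomPoly_ne_zero : denomPoly N ν ≠ 0 := by
    intro h
    simpa [h] using eval_denomPoly.2 (hahnFormulaDefined_zero hν)
  refine mvPolynomial_eq_of_eval_eq denomPoly_ne_zero fun x hx => ?_
  have hx' := eval_denomPoly.1 hx
  rw [hP.2 x hx', eval_hahnPoly_of_hahnFormulaDefined hx']

end HahnPolynomial

section TailBounds

/-- Sum of the entries of `f` strictly before position `m`, where `m` may also be the length. -/
def headSum {d : ℕ} (f : Fin d → ℕ) (m : ℕ) : ℕ := ∑ i ∈ univ.filter (·.val < m), f i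

/-- Sum of the entries of `f` from position `m` on, where `m` may also be the length. -/
def tailSum {d : ℕ} (f : Fin d → ℕ) (m : ℕ) : ℕ := ∑ i ∈ univ.filter (m ≤ ·.val), f i

variable {d : ℕ}

theorem headSum_zero (f : Fin d → ℕ) : headSum f 0 = 0 := by
  simp [headSum]

theorem headSum_self (f : Fin d → ℕ) : headSum f d = ∑ i, f i := by
  simp [headSum]

theorem headSum_succ (f : Fin d → ℕ) (j : Fin d) : headSum f (j + 1) = headSum f j + f j := by
  have insert_eq :
      univ.filter (fun i : Fin d => i.val < j + 1) = insert j (univ.filter (·.val < j.val)) := by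
    grind
  rw [headSum, insert_eq, sum_insert (by simp), add_comm, headSum]

theorem tailSum_zero (f : Fin d → ℕ) : tailSum f 0 = ∑ i, f i := by
  simp [tailSum]

theorem tailSum_self (f : Fin d → ℕ) : tailSum f d = 0 := by
  simp [tailSum]

theorem tailSum_eq_add (f : Fin d → ℕ) (j : Fin d) : tailSum f j = f j + tailSum f (j + 1) := by
  have insert_eq :
      univ.filter (fun i : Fin d => j.val ≤ i) = insert j (univ.filter (j.val + 1 ≤ ·.val)) := by
    grind
  rw [tailSum, insert_eq, sum_insert (by simp), tailSum]

theorem levelN_natCast (N : ℕ) (ν x : Fin d → ℕ) (j : Fin d) :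
    levelN N ν (fun i => (x i : ℝ)) j = N - headSum x j - tailSum ν (j + 1) := by
  rw [levelN, sumBefore, headSum, Nat.cast_sum]
  rfl

theorem zaParam_eq_tailSum (ℓ : Fin (d + 1) → ℕ) (ν : Fin d → ℕ) (j : Fin d) :
    zaParam ℓ ν j = tailSum ℓ (j + 1) - 2 * tailSum ν (j + 1) :=
  rfl

/-- For `x` completed by the entry `x_{d+1} = N - |x|`, the entries of `ν` from position `m` on sum
to at most those of `x`, and to at most those of `ℓ - x`. Subtractions are moved to the other
side. -/
def TailBounds (ℓ : Fin (d + 1) → ℕ) (N : ℕ) (ν x : Fin d → ℕ) (m : ℕ) : Prop :=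
  tailSum ν m + headSum x m ≤ N ∧ tailSum ν m + N ≤ tailSum ℓ m + headSum x m

variable {ℓ : Fin (d + 1) → ℕ} {N : ℕ} {ν x : Fin d → ℕ}

theorem tailBounds_self (hx : x ∈ hahnV ℓ N) : TailBounds ℓ N ν x d := by
  obtain ⟨-, hlower, hupper⟩ := hx
  have tail_ℓ : tailSum ℓ d = ℓ (Fin.last d) := by
    simpa [tailSum_self] using tailSum_eq_add ℓ (Fin.last d)
  rw [TailBounds, tailSum_self, headSum_self, tail_ℓ]
  lia

theorem TailBounds.of_clearedHahn_ne_zero {j : Fin d} (hxℓ : x j ≤ ℓ j.castSucc)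
    (h : TailBounds ℓ N ν x (j + 1))
    (hne : clearedHahn (ν j) (x j : ℝ) (ℓ j.castSucc) (zaParam ℓ ν j)
      (levelN N ν (fun i => (x i : ℝ)) j) ≠ 0) :
    ν j ≤ zaParam ℓ ν j ∧ TailBounds ℓ N ν x j := by
  obtain ⟨hupper, hlower⟩ := h
  have head := headSum_succ x j
  obtain ⟨y, hy⟩ := Nat.exists_eq_add_of_le hupper
  obtain ⟨a, ha⟩ : ∃ a : ℕ, zaParam ℓ ν j = a :=
    Int.eq_ofNat_of_zero_le (by rw [zaParam_eq_tailSum]; lia)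
  have tail := zaParam_eq_tailSum ℓ ν j
  have level : levelN N ν (fun i => (x i : ℝ)) j = x j + y := by
    rw [levelN_natCast, hy, head]
    push_cast
    ring
  rw [level, ha, Int.cast_natCast] at hne
  have bounds := le_of_clearedHahn_ne_zero hxℓ (by lia) hne
  have tail_ℓ := tailSum_eq_add ℓ j.castSucc
  have tail_ν := tailSum_eq_add ν j
  rw [Fin.val_castSucc] at tail_ℓ
  exact ⟨by lia, by lia, by lia⟩

theorem tailBounds_of_clearedHahn_ne_zero (hx : x ∈ hahnV ℓ N)
    (hne : ∀ j, clearedHahn (ν j) (x j : ℝ) (ℓ j.castSucc) (zaParam ℓ ν j)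
      (levelN N ν (fun i => (x i : ℝ)) j) ≠ 0) {m : ℕ} (hm : m ≤ d) :
    TailBounds ℓ N ν x m := by
  induction hm using Nat.decreasingInduction with
  | self => exact tailBounds_self hx
  | of_succ m hm ih => exact (ih.of_clearedHahn_ne_zero (hx.1 ⟨m, hm⟩) (hne ⟨m, hm⟩)).2

theorem mem_hahnH_of_eval_hahnPoly_ne_zero (hν : ν ∈ hahnCalH ℓ N) (hx : x ∈ hahnV ℓ N)
    (hne : MvPolynomial.eval (fun i => (x i : ℝ)) (hahnPoly ℓ N ν) ≠ 0) : ν ∈ hahnH ℓ N := by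
  rw [eval_hahnPoly, prod_ne_zero_iff] at hne
  have factor_ne_zero j := right_ne_zero_of_mul (hne j (mem_univ j))
  have bounds {m : ℕ} (hm : m ≤ d) := tailBounds_of_clearedHahn_ne_zero hx factor_ne_zero hm
  have total := (bounds (Nat.zero_le d)).2
  rw [tailSum_zero, tailSum_zero, headSum_zero] at total
  exact ⟨hν.2, by lia, fun j => ⟨hν.1 j,
    ((bounds j.isLt).of_clearedHahn_ne_zero (hx.1 j) (factor_ne_zero j)).1⟩⟩

end TailBounds

theorem theorem3p4_general (d : ℕ) (ℓ : Fin (d + 1) → ℕ) (N : ℕ) :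
    (∀ ν ∈ hahnCalH ℓ N, ∃! P : MvPolynomial (Fin d) ℝ, IsHahnPolynomial ℓ N ν P) ∧
    (∀ ν ∈ hahnCalH ℓ N \ hahnH ℓ N, ∀ P : MvPolynomial (Fin d) ℝ, IsHahnPolynomial ℓ N ν P →
      ∀ x ∈ hahnV ℓ N, MvPolynomial.eval (fun i => (x i : ℝ)) P = 0) := by
  constructor
  · intro ν hν
    exact ⟨hahnPoly ℓ N ν, isHahnPolynomial_hahnPoly hν, fun P hP => hP.eq_hahnPoly hν⟩
  · rintro ν ⟨hν, hνH⟩ P hP x hx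
    rw [hP.eq_hahnPoly hν]
    by_contra hne
    exact hνH (mem_hahnH_of_eval_hahnPoly_ne_zero hν hx hne)

theorem theorem3p4 (d : ℕ) (ℓ : Fin (d + 1) → ℕ) (N : ℕ) (hN : 0 < N) (hℓ : ∀ i, 0 < ℓ i)
    (hℓN : ∀ i, ℓ i ≤ N) (hℓℓ : ∀ i j, i ≠ j → N ≤ ℓ i + ℓ j) :
    (∀ ν ∈ hahnCalH ℓ N, ∃! P : MvPolynomial (Fin d) ℝ, IsHahnPolynomial ℓ N ν P) ∧
    (∀ ν ∈ hahnCalH ℓ N \ hahnH ℓ N, ∀ P : MvPolynomial (Fin d) ℝ, IsHahnPolynomial ℓ N ν P →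
      ∀ x ∈ hahnV ℓ N, MvPolynomial.eval (fun i => (x i : ℝ)) P = 0) :=
  theorem3p4_general d ℓ N
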